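/- Let $X$ be an $n$-dimensional toric Fano manifold, and let $\overline{\Delta}\subset\mathbb{R}^n$ be its anticanonical moment polytope, a reflexive integral Delzant polytope, with interior $\Delta\ni 0$. Let $\omega_0\in 2\pi c_1(X)$ be an $(S^1)^n$-invariant Kähler metric, written as $\omega_0=\sqrt{-1}\,\partial\overline{\partial}\phi_0$ on the open orbit $(\mathbb{C}^*)^n$ with $\phi_0=\phi_0(\xi)$, $\xi_i=\log|z_i|^2$, where $\phi_0$ is normalized so that $e^{-\phi_0}$ extends to a smooth Hermitian metric on $-K_X$ (equivalently, $\nabla\phi_0(\mathbb{R}^n)=\Delta$). Let $u_0(x)=\sup_{\xi\in\mathbb{R}^n}(x\cdot\xi-\phi_0(\xi))$ be its Legendre dual, and put $$\mathcal{C}=\{u\in C^0(\overline{\Delta}) : u \text{ is convex on } \Delta,\ u-u_0\in C^\infty(\overline{\Delta})\},\qquad \tilde{\mathcal{C}}=\{u\in\mathcal{C} : u\ge u(0)=0\}.$$ Let $l$ be the unique affine function on $\mathbb{R}^n$ such that $\int_\Delta f\,l\,dx=f(0)$ for every affine function $f$, let $|\Delta|$ be the volume of $\Delta$, and for $u\in\mathcal{C}$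 with Legendre dual $\phi(\xi)=\sup_{x\in\overline{\Delta}}(x\cdot\xi-u(x))$ put $$\alpha_X=\max_{\overline{\Delta}}(1-|\Delta|\,l),\qquad \mathcal{I}(u)=-u(0)+\int_\Delta u\,l\,dx,$$ $$\mathcal{D}(u)=-\log\int_{\mathbb{R}^n}e^{-(\phi-\inf\phi)}\,d\xi-u(0)+\int_\Delta u\,l\,dx.$$ Then the following three conditions are equivalent. (a) $\alpha_X\le 1$. (b) $X$ is relative Ding stable, i.e. $\mathcal{I}(u)\ge 0$ for all $u\in\tilde{\mathcal{C}}$. (c) For every $\varepsilon>0$ there is a constant $C_\varepsilon>0$ such that $\mathcal{D}(u)\ge-\varepsilon\int_\Delta u\,dx-C_\varepsilon$ for all $u\in\tilde{\mathcal{C}}$. -/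

import Mathlib

open Set MeasureTheory
open scoped ContDiff RealInnerProductSpace

noncomputable section

namespace ToricFano

/-- `ℝⁿ` with its Euclidean structure and Lebesgue measure. -/
abbrev E (n : ℕ) : Type := EuclideanSpace ℝ (Fin n)

/-- A lattice point of `ℤⁿ` viewed in `ℝⁿ`. -/
def intVec {n : ℕ} (a : Fin n → ℤ) : E n := WithLp.toLp 2 (fun i => (a i : ℝ))

/-- Lattice polytopes: convex hulls of finitely many points of `ℤⁿ`. -/
def IsLatticePolytope {n : ℕ} (P : Set (E n)) : Prop :=
  ∃ S : Finset (Fin n → ℤ), P = convexHull ℝ (intVec '' (S : Set (Fin n → ℤ)))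

/-- The polar dual of `P`. -/
def polarDual {n : ℕ} (P : Set (E n)) : Set (E n) := {y | ∀ x ∈ P, ⟪x, y⟫ ≤ 1}

/-- The rows of `m` form a `ℤ`-basis of `ℤⁿ` and generate the edges of `P` at `p`: the cone of
directions along which one can move from `p` inside `P` is the cone spanned by the rows. -/
def IsEdgeBasis {n : ℕ} (P : Set (E n)) (p : E n) (m : Matrix (Fin n) (Fin n) ℤ) : Prop :=
  IsUnit m.det ∧
    {v : E n | ∃ t : ℝ, 0 < t ∧ p + t • v ∈ P} =
      {v : E n | ∃ c : Fin n → ℝ, (∀ j, 0 ≤ c j) ∧ v = ∑ j, c j • intVec (m j)}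

/-- The moment polytope of an `n`-dimensional toric Fano manifold with its anticanonical
polarization: a reflexive integral Delzant polytope. -/
structure Polytope (n : ℕ) where
  /-- the closed polytope -/
  carrier : Set (E n)
  /-- it is a lattice polytope -/
  lattice : IsLatticePolytope carrier
  /-- the origin is an interior point -/
  zero_mem : (0 : E n) ∈ interior carrier
  /-- reflexivity: the polar dual is a lattice polytope too -/
  reflexive : IsLatticePolytope (polarDual carrier)
  /-- the Delzant condition at every vertex -/
  delzant : ∀ p ∈ carrier.extremePoints ℝ, ∃ m, IsEdgeBasis carrier p m

/-- The open polytope `Δ`; its closure is `P.carrier`. -/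
def Polytope.delta {n : ℕ} (P : Polytope n) : Set (E n) := interior P.carrier

/-- `ξ_i = log |z_i|²` on the torus `(ℂ^*)ⁿ`. -/
def logCoord {n : ℕ} (z : Fin n → ℂ) : E n := WithLp.toLp 2 (fun i => Real.log (‖z i‖ ^ 2))

/-- The monomial change of coordinates `w_j = ∏_i z_i ^ (m_{j i})`. If the rows of `m` are the edge
generators at a vertex, this is the transition from the torus to the affine chart `ℂⁿ` of the toric
manifold centred at the fixed point of that vertex. -/
def toricChart {n : ℕ} (m : Matrix (Fin n) (Fin n) ℤ) (z : Fin n → ℂ) : Fin n → ℂ :=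
  fun j => ∏ i, z i ^ m j i

/-- Smooth functions on `ℂⁿ` with `√-1 ∂∂̄ F > 0`: the Levi form
`(D²F(v, v) + D²F(iv, iv)) / 4` is positive definite at every point. -/
def IsKahlerPotential {n : ℕ} (F : (Fin n → ℂ) → ℝ) : Prop :=
  ContDiff ℝ ∞ F ∧ ∀ w v : Fin n → ℂ, v ≠ 0 →
    0 < fderiv ℝ (fderiv ℝ F) w v v +
      fderiv ℝ (fderiv ℝ F) w (Complex.I • v) (Complex.I • v)

/-- `φ₀ : ℝⁿ → ℝ` is the potential of an `(S¹)ⁿ`-invariant Kähler metric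
`ω₀ = √-1 ∂∂̄ φ₀ ∈ 2π c₁(X)`, where `X` is the toric manifold of `P`.  That is, `e^{-φ₀}` is an
invariant positively curved smooth Hermitian metric on `-K_X`: the affine charts `ℂⁿ` of the
vertices `p` cover `X`, and with respect to the local frame of `-K_X` over such a chart the weight of
the metric is `φ₀ - ⟨p, ξ⟩`, which has to extend from the torus to a smooth function on `ℂⁿ` with
positive `√-1 ∂∂̄`. -/
def IsReferencePotential {n : ℕ} (P : Polytope n) (φ₀ : E n → ℝ) : Prop :=
  ∀ p ∈ P.carrier.extremePoints ℝ, ∀ m, IsEdgeBasis P.carrier p m →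
    ∃ F : (Fin n → ℂ) → ℝ, IsKahlerPotential F ∧
      ∀ z : Fin n → ℂ, (∀ i, z i ≠ 0) →
        F (toricChart m z) = φ₀ (logCoord z) - ⟪p, logCoord z⟫

/-- The Legendre dual of a function on `ℝⁿ`. -/
def legendre {n : ℕ} (φ : E n → ℝ) (x : E n) : ℝ := ⨆ ξ : E n, (⟪x, ξ⟫ - φ ξ)

/-- The Legendre dual of a function on the closed polytope. -/
def Polytope.legendre {n : ℕ} (P : Polytope n) (u : E n → ℝ) (ξ : E n) : ℝ :=
  ⨆ x : P.carrier, (⟪(x : E n), ξ⟫ - u x)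

/-- The space `𝒞`: functions continuous on the closed polytope, convex on `Δ`, that differ from the
Legendre dual of `φ₀` by a function smooth up to the boundary. Only the values on the closed
polytope matter. -/
def Polytope.potentials {n : ℕ} (P : Polytope n) (φ₀ : E n → ℝ) : Set (E n → ℝ) :=
  {u | ContinuousOn u P.carrier ∧ ConvexOn ℝ P.delta u ∧
    ContDiffOn ℝ ∞ (fun x => u x - ToricFano.legendre φ₀ x) P.carrier}

/-- The normalized potentials `𝒞̃`: those with `u ≥ u 0 = 0`. -/
def Polytope.normalizedPotentials {n : ℕ} (P : Polytope n) (φ₀ : E n → ℝ) : Set (E n → ℝ) :=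
  {u | u ∈ P.potentials φ₀ ∧ (∀ x ∈ P.carrier, u 0 ≤ u x) ∧ u 0 = 0}

lemma Polytope.isCompact_carrier {n : ℕ} (P : Polytope n) : IsCompact P.carrier := by
  obtain ⟨S, hS⟩ := P.lattice
  rw [hS]
  exact (S.finite_toSet.image _).isCompact_convexHull ℝ

lemma Polytope.integrableOn_delta {n : ℕ} (P : Polytope n) {f : E n → ℝ} (hf : Continuous f) :
    IntegrableOn f P.delta :=
  (hf.continuousOn.integrableOn_compact P.isCompact_carrier).mono_set interior_subset

lemma Polytope.affine_eq_zero {n : ℕ} (P : Polytope n) (l : E n →ᵃ[ℝ] ℝ)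
    (h : ∫ x in P.delta, l x * l x = 0) : l = 0 := by
  have hc : Continuous l := l.continuous_of_finiteDimensional
  have ho : IsOpen P.delta := isOpen_interior
  have h1 := (setIntegral_eq_zero_iff_of_nonneg_ae
    (Filter.Eventually.of_forall fun x => mul_self_nonneg (l x))
    (P.integrableOn_delta (hc.mul hc))).1 h
  have h2 : EqOn (fun x => l x * l x) 0 P.delta :=
    Measure.eqOn_open_of_ae_eq h1 ho (hc.mul hc).continuousOn continuousOn_const
  have h3 : EqOn l 0 P.delta := fun x hx => mul_self_eq_zero.1 (h2 hx)
  have hspan : affineSpan ℝ P.delta = ⊤ := ho.affineSpan_eq_top ⟨0, P.zero_mem⟩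
  ext x
  have hx : x ∈ affineSpan ℝ P.delta := by rw [hspan]; trivial
  exact (AffineMap.eqOn_affineSpan (f := l) (g := 0) h3) hx

/-- Existence and uniqueness of the affine function `l` with `∫_Δ f l dx = f(0)` for all affine
functions `f`. -/
lemma Polytope.existsUnique_ell {n : ℕ} (P : Polytope n) :
    ∃! l : E n →ᵃ[ℝ] ℝ, ∀ f : E n →ᵃ[ℝ] ℝ, -f 0 + ∫ x in P.delta, f x * l x = 0 := by
  classical
  have hint : ∀ f g : E n →ᵃ[ℝ] ℝ, IntegrableOn (fun x => f x * g x) P.delta := fun f g =>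
    P.integrableOn_delta
      (f.continuous_of_finiteDimensional.mul g.continuous_of_finiteDimensional)
  have : FiniteDimensional ℝ (E n →ᵃ[ℝ] ℝ) :=
    Module.Finite.equiv (AffineMap.toConstProdLinearMap ℝ (V1 := E n) (V2 := ℝ)).symm
  let B : (E n →ᵃ[ℝ] ℝ) →ₗ[ℝ] Module.Dual ℝ (E n →ᵃ[ℝ] ℝ) :=
    LinearMap.mk₂ ℝ (fun l f => ∫ x in P.delta, f x * l x)
      (fun l l' f => by
        simp only [AffineMap.coe_add, Pi.add_apply, mul_add]
        exact integral_add (hint f l) (hint f l'))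
      (fun c l f => by
        simp only [AffineMap.coe_smul, Pi.smul_apply, smul_eq_mul, mul_left_comm _ c]
        exact integral_const_mul _ _)
      (fun l f f' => by
        simp only [AffineMap.coe_add, Pi.add_apply, add_mul]
        exact integral_add (hint f l) (hint f' l))
      (fun c l f => by
        simp only [AffineMap.coe_smul, Pi.smul_apply, smul_eq_mul, mul_assoc]
        exact integral_const_mul _ _)
  have hB : Function.Injective B := by
    rw [injective_iff_map_eq_zero]
    intro l hl
    exact P.affine_eq_zero l (by simpa [B] using LinearMap.congr_fun hl l)
  have hS : Function.Surjective B :=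
    (LinearMap.injective_iff_surjective_of_finrank_eq_finrank
      Subspace.dual_finrank_eq.symm).1 hB
  let ev : Module.Dual ℝ (E n →ᵃ[ℝ] ℝ) :=
    { toFun := fun f => f 0
      map_add' := fun _ _ => rfl
      map_smul' := fun _ _ => rfl }
  have key : ∀ l, (∀ f : E n →ᵃ[ℝ] ℝ, -f 0 + ∫ x in P.delta, f x * l x = 0) ↔ B l = ev := by
    intro l
    rw [LinearMap.ext_iff]
    refine forall_congr' fun f => ?_
    change _ ↔ ∫ x in P.delta, f x * l x = f 0
    constructor <;> intro h <;> linarith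
  obtain ⟨l, hl⟩ := hS ev
  exact ⟨l, (key l).2 hl, fun l' h' => hB (((key l').1 h').trans hl.symm)⟩

/-- The unique affine function `l` with `-f(0) + ∫_Δ f l dx = 0` for all affine functions `f`. -/
def Polytope.ell {n : ℕ} (P : Polytope n) : E n →ᵃ[ℝ] ℝ := P.existsUnique_ell.choose

/-- The volume `|Δ|`. -/
def Polytope.vol {n : ℕ} (P : Polytope n) : ℝ := ∫ _x in P.delta, (1 : ℝ)

/-- The invariant `α_X`, the maximum of `1 - |Δ| l` over the closed polytope. -/
def Polytope.alpha {n : ℕ} (P : Polytope n) : ℝ :=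
  sSup ((fun x => 1 - P.vol * P.ell x) '' P.carrier)

/-- The relative Ding–Futaki invariant `ℐ(u) = -u(0) + ∫_Δ u l dx`. -/
def Polytope.dingFutaki {n : ℕ} (P : Polytope n) (u : E n → ℝ) : ℝ :=
  -u 0 + ∫ x in P.delta, u x * P.ell x

/-- The modified Ding functional
`𝒟(u) = -log ∫_{ℝⁿ} e^{-(φ - inf φ)} dξ - u(0) + ∫_Δ u l dx`, with `φ` the Legendre dual of `u`. -/
def Polytope.ding {n : ℕ} (P : Polytope n) (u : E n → ℝ) : ℝ :=
  -Real.log (∫ ξ : E n, Real.exp (-(P.legendre u ξ - ⨅ η : E n, P.legendre u η)))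
    - u 0 + ∫ x in P.delta, u x * P.ell x

end ToricFano

end

/-!
Testing the definition of `l` with `f = 1` and `f = l` gives `∫ l = 1` and `∫ l² = l(0)`, and
`α_X ≤ 1` says exactly that `l ≥ 0` on the closed polytope (`alpha_le_one_iff`).

If `l ≥ 0`, then `ℐ(u) = ∫ u l ≥ 0` for normalized `u`. For the Ding functional, a normalized `u` is
bounded by `A ∫ u` on a ball of radius `r` about the origin (`exists_le_mul_integral`), hence by
`δ A ∫ u` on the ball of radius `δ r`, by convexity and `u(0) = 0`. So the Legendre dual satisfies
`φ ≥ δ r ‖ξ‖ - δ A ∫ u`, and `-log ∫ e^{-φ} ≥ -δ A ∫ u - C_δ`, where `δ` is arbitrary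
(`exists_le_ding`). Therefore `ℐ ≥ 0` implies the lower bound for `𝒟 = -log ∫ e^{-φ} + ℐ`.

If `l < 0` somewhere, take for `h` the function `e^{-s l}` minus its affine Taylor polynomial at the
origin. It is convex, nonnegative and smooth, vanishes at the origin, and since `ℐ` kills affine
functions, `ℐ(h) = ∫ e^{-s l} l - e^{-s l(0)} < 1 - s ∫ min(l, 0)²`, which is negative for large `s`
(`exists_destabilizing`). Adding `K h` to a fixed normalized potential and letting `K → ∞`
contradicts the lower bound for `𝒟`, because `φ ≤ R ‖ξ‖` gives `𝒟 ≤ ℐ + B`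
(`exists_ding_le`).

That step needs a normalized potential to start from: the Legendre dual `u₀` of `φ₀`, minus a
supporting affine function at the origin (`exists_normalizedPotential`). In the chart of a vertex
`p` the normal cone of `p` corresponds to the unit polydisc, where the weight `φ₀ - ⟨p, ξ⟩` is
bounded; so `φ₀` dominates the support function of the polytope up to a constant, and `u₀` is
bounded. It is convex and lower semicontinuous as a supremum of affine functions, and on a set cut
out by finitely many linear inequalities this implies continuity up to the boundary
(`continuousOn_of_convexOn`).
-/

namespace ToricFano

open Filter Topology

variable {n : ℕ}

/-! ### Convexity of the moment polytope -/

lemma Polytope.convex_carrier (P : Polytope n) : Convex ℝ P.carrier := by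
  obtain ⟨S, hS⟩ := P.lattice
  rw [hS]
  exact convex_convexHull ℝ _

lemma Polytope.zero_mem_carrier (P : Polytope n) : (0 : E n) ∈ P.carrier :=
  interior_subset P.zero_mem

lemma Polytope.finite_extremePoints (P : Polytope n) : (P.carrier.extremePoints ℝ).Finite := by
  obtain ⟨S, hS⟩ := P.lattice
  rw [hS]
  exact (S.finite_toSet.image _).subset extremePoints_convexHull_subset

lemma Polytope.convex_delta (P : Polytope n) : Convex ℝ P.delta := P.convex_carrier.interior

lemma Polytope.carrier_subset_closure (P : Polytope n) : P.carrier ⊆ closure P.delta := by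
  have h := P.convex_carrier.closure_interior_eq_closure_of_nonempty_interior ⟨0, P.zero_mem⟩
  rw [Polytope.delta, h]
  exact subset_closure

lemma Polytope.exists_closedBall_subset (P : Polytope n) :
    ∃ r : ℝ, 0 < r ∧ Metric.closedBall (0 : E n) r ⊆ P.delta :=
  Metric.nhds_basis_closedBall.mem_iff.1 (isOpen_interior.mem_nhds P.zero_mem)

/-- The bipolar theorem turns reflexivity into a description of the polytope by finitely many linear
inequalities. -/
lemma Polytope.exists_inequalities (P : Polytope n) :
    ∃ T : Finset (E n), P.carrier = {x | ∀ s ∈ T, ⟪x, s⟫ ≤ 1} := by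
  classical
  obtain ⟨S, hS⟩ := P.reflexive
  refine ⟨S.image intVec, Subset.antisymm (fun x hx s hs => ?_) (fun x hx => ?_)⟩
  · obtain ⟨a, ha, rfl⟩ := Finset.mem_image.1 hs
    have : intVec a ∈ polarDual P.carrier := by
      rw [hS]
      exact subset_convexHull ℝ _ ⟨a, ha, rfl⟩
    exact this x hx
  · have hx' : ∀ y ∈ polarDual P.carrier, ⟪x, y⟫ ≤ 1 := by
      intro y hy
      rw [hS] at hy
      have hc : Convex ℝ {y : E n | ⟪x, y⟫ ≤ 1} :=
        convex_halfSpace_le (innerₛₗ ℝ x).isLinear 1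
      refine convexHull_min ?_ hc hy
      rintro _ ⟨a, ha, rfl⟩
      exact hx _ (Finset.mem_image_of_mem _ ha)
    by_contra hn
    obtain ⟨f, c, hc, hfx⟩ := geometric_hahn_banach_closed_point P.convex_carrier
      P.isCompact_carrier.isClosed hn
    have hc0 : 0 < c := by simpa using hc 0 P.zero_mem_carrier
    let y := (InnerProductSpace.toDual ℝ (E n)).symm f
    have hy : ∀ z, ⟪z, y⟫ = f z := fun z => by
      rw [real_inner_comm]
      exact InnerProductSpace.toDual_symm_apply
    have h1 : c⁻¹ • y ∈ polarDual P.carrier := by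
      intro z hz
      rw [inner_smul_right, hy, inv_mul_le_iff₀ hc0]
      linarith [hc z hz]
    have h2 := hx' _ h1
    rw [inner_smul_right, hy, inv_mul_le_iff₀ hc0] at h2
    linarith

/-- Near a point `x` of the polytope, the polytope is contained in its own homothetic shrinkings
with centre `x`: inequalities active at `x` are invariant under homothety, the others are strict. -/
lemma Polytope.eventually_homothety_mem (P : Polytope n) {x : E n} (hx : x ∈ P.carrier) (t : ℝ)
    (ht : 0 < t) : ∀ᶠ y in 𝓝[P.carrier] x, x + t • (y - x) ∈ P.carrier := by
  obtain ⟨T, hT⟩ := P.exists_inequalities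
  have key : ∀ s ∈ T, ∀ᶠ y in 𝓝[P.carrier] x, ⟪x + t • (y - x), s⟫ ≤ 1 := by
    intro s hs
    have hxs : ⟪x, s⟫ ≤ 1 := by
      rw [hT] at hx
      exact hx s hs
    rcases hxs.lt_or_eq with h | h
    · have hc : Continuous fun y : E n => ⟪x + t • (y - x), s⟫ := by fun_prop
      refine nhdsWithin_le_nhds ((hc.tendsto x).eventually_le_const ?_)
      simpa using h
    · filter_upwards [self_mem_nhdsWithin] with y hy
      rw [hT] at hy
      have := hy s hs
      rw [inner_add_left, inner_smul_left, inner_sub_left]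
      simp only [conj_trivial]
      nlinarith
  have := (Finset.eventually_all T).2 key
  filter_upwards [this] with y hy
  rw [hT]
  exact hy

/-- A bounded lower semicontinuous convex function on the polytope is continuous up to the
boundary. -/
lemma Polytope.continuousOn_of_convexOn (P : Polytope n) {f : E n → ℝ} {M : ℝ}
    (hf : ConvexOn ℝ P.carrier f) (hl : LowerSemicontinuousOn f P.carrier)
    (hM : ∀ x ∈ P.carrier, f x ≤ M) : ContinuousOn f P.carrier := by
  intro x hx
  refine tendsto_order.2 ⟨fun a ha => hl x hx a ha, fun a ha => ?_⟩
  -- `y` is the point of parameter `s` on a segment from `x` to a point of the polytope, so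
  -- `f y ≤ (1 - s) f x + s M`, and `s` is at our disposal.
  obtain ⟨s, hs0, hs1, hs⟩ : ∃ s : ℝ, 0 < s ∧ s < 1 ∧ (1 - s) * f x + s * M < a := by
    have hc : Continuous fun s : ℝ => (1 - s) * f x + s * M := by fun_prop
    have h1 : ∀ᶠ s in 𝓝[>] (0 : ℝ), (1 - s) * f x + s * M < a := by
      refine nhdsWithin_le_nhds ((hc.tendsto 0).eventually_lt_const ?_)
      simpa using ha
    have h2 : ∀ᶠ s in 𝓝[>] (0 : ℝ), s < 1 :=
      nhdsWithin_le_nhds (gt_mem_nhds zero_lt_one)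
    have h3 : ∀ᶠ s in 𝓝[>] (0 : ℝ), 0 < s := self_mem_nhdsWithin
    obtain ⟨s, h⟩ := (h3.and (h2.and h1)).exists
    exact ⟨s, h.1, h.2.1, h.2.2⟩
  filter_upwards [P.eventually_homothety_mem hx s⁻¹ (inv_pos.2 hs0)] with y hy
  have h := hf.2 hx hy (sub_nonneg.2 hs1.le) hs0.le (by ring)
  have he : (1 - s) • x + s • (x + s⁻¹ • (y - x)) = y := by
    rw [smul_add, smul_smul, mul_inv_cancel₀ hs0.ne', one_smul, sub_smul, one_smul]
    abel
  rw [he] at h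
  simp only [smul_eq_mul] at h
  nlinarith [hM _ hy]

/-- A linear functional attains its maximum over the polytope at a vertex. -/
lemma Polytope.exists_vertex_isMaxOn (P : Polytope n) (ξ : E n) :
    ∃ p ∈ P.carrier.extremePoints ℝ, ∀ x ∈ P.carrier, ⟪x, ξ⟫ ≤ ⟪p, ξ⟫ := by
  let f : StrongDual ℝ (E n) := innerSL ℝ ξ
  have hexp : IsExposed ℝ P.carrier (f.toExposed P.carrier) :=
    ContinuousLinearMap.toExposed.isExposed
  obtain ⟨x, hx, hmax⟩ := P.isCompact_carrier.exists_isMaxOn ⟨0, P.zero_mem_carrier⟩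
    f.continuous.continuousOn
  obtain ⟨p, hp⟩ := (hexp.isCompact P.isCompact_carrier).extremePoints_nonempty
    ⟨x, hx, fun y hy => hmax hy⟩
  refine ⟨p, hexp.isExtreme.extremePoints_subset_extremePoints hp, fun y hy => ?_⟩
  have := (extremePoints_subset hp).2 y hy
  simpa [f, real_inner_comm] using this

/-! ### Growth of the reference potential -/

/-- A positive real point of the torus with prescribed logarithmic coordinates. -/
noncomputable def torusPoint (ξ : E n) : Fin n → ℂ := fun i => (Real.exp (ξ i / 2) : ℝ)

lemma torusPoint_ne_zero (ξ : E n) (i : Fin n) : torusPoint ξ i ≠ 0 :=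
  Complex.ofReal_ne_zero.2 (Real.exp_pos _).ne'

lemma logCoord_torusPoint (ξ : E n) : logCoord (torusPoint ξ) = ξ := by
  ext i
  simp only [logCoord, torusPoint, Complex.norm_real, Real.norm_eq_abs, Real.abs_exp, Real.log_pow,
    Real.log_exp]
  push_cast
  ring

lemma norm_toricChart_torusPoint (m : Matrix (Fin n) (Fin n) ℤ) (ξ : E n) (j : Fin n) :
    ‖toricChart m (torusPoint ξ) j‖ = Real.exp (⟪intVec (m j), ξ⟫ / 2) := by
  simp only [toricChart, torusPoint, norm_prod, norm_zpow, Complex.norm_real, Real.norm_eq_abs,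
    Real.abs_exp, ← Real.rpow_intCast, ← Real.exp_mul, ← Real.exp_sum, PiLp.inner_apply, intVec]
  rw [Finset.sum_div]
  congr 1
  refine Finset.sum_congr rfl fun i _ => ?_
  simp
  ring

lemma continuous_toricChart_torusPoint (m : Matrix (Fin n) (Fin n) ℤ) :
    Continuous fun ξ : E n => toricChart m (torusPoint ξ) := by
  refine continuous_pi fun j => continuous_finsetProd _ fun i _ => ?_
  have : Continuous fun ξ : E n => torusPoint ξ i := by
    unfold torusPoint
    fun_prop
  exact this.zpow₀ _ fun ξ => Or.inl (torusPoint_ne_zero ξ i)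

variable {P : Polytope n} {φ₀ : E n → ℝ}

lemma IsReferencePotential.continuous (hφ₀ : IsReferencePotential P φ₀) : Continuous φ₀ := by
  obtain ⟨p, hp, -⟩ := P.exists_vertex_isMaxOn 0
  obtain ⟨m, hm⟩ := P.delzant p hp
  obtain ⟨F, hF, h⟩ := hφ₀ p hp m hm
  have h1 : φ₀ = fun ξ => F (toricChart m (torusPoint ξ)) + ⟪p, ξ⟫ := by
    ext ξ
    rw [h _ (torusPoint_ne_zero ξ), logCoord_torusPoint]
    ring
  rw [h1]
  exact (hF.1.continuous.comp (continuous_toricChart_torusPoint m)).add (by fun_prop)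

/-- On the normal cone of the vertex `p` the torus lies in the closed unit polydisc of the chart
centred at `p`, where the weight of the metric is bounded. -/
lemma IsReferencePotential.exists_vertex_bound (hφ₀ : IsReferencePotential P φ₀) {p : E n}
    (hp : p ∈ P.carrier.extremePoints ℝ) :
    ∃ C : ℝ, ∀ ξ, (∀ x ∈ P.carrier, ⟪x, ξ⟫ ≤ ⟪p, ξ⟫) → ⟪p, ξ⟫ - φ₀ ξ ≤ C := by
  obtain ⟨m, hm⟩ := P.delzant p hp
  obtain ⟨F, hF, h⟩ := hφ₀ p hp m hm
  obtain ⟨C, hC⟩ := ((isCompact_closedBall (0 : Fin n → ℂ) 1).image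
    hF.1.continuous).bddBelow
  refine ⟨-C, fun ξ hξ => ?_⟩
  have hmem : toricChart m (torusPoint ξ) ∈ Metric.closedBall (0 : Fin n → ℂ) 1 := by
    rw [mem_closedBall_zero_iff, pi_norm_le_iff_of_nonneg zero_le_one]
    intro j
    rw [norm_toricChart_torusPoint, Real.exp_le_one_iff]
    have : intVec (m j) ∈ {v : E n | ∃ t : ℝ, 0 < t ∧ p + t • v ∈ P.carrier} := by
      rw [hm.2]
      refine ⟨fun k => if k = j then 1 else 0, fun k => ?_, by simp⟩
      dsimp only
      split_ifs <;> norm_num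
    obtain ⟨t, ht, htP⟩ := this
    have h1 := hξ _ htP
    rw [inner_add_left, inner_smul_left] at h1
    simp only [conj_trivial] at h1
    nlinarith
  have h2 := hC (mem_image_of_mem F hmem)
  rw [h _ (torusPoint_ne_zero ξ), logCoord_torusPoint] at h2
  linarith

/-- The reference potential dominates the support function of the polytope up to a constant. -/
lemma IsReferencePotential.exists_bound (hφ₀ : IsReferencePotential P φ₀) :
    ∃ C : ℝ, ∀ x ∈ P.carrier, ∀ ξ, ⟪x, ξ⟫ - φ₀ ξ ≤ C := by
  have h : ∀ p : E n, ∃ C : ℝ, p ∈ P.carrier.extremePoints ℝ →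
      ∀ ξ, (∀ x ∈ P.carrier, ⟪x, ξ⟫ ≤ ⟪p, ξ⟫) → ⟪p, ξ⟫ - φ₀ ξ ≤ C := by
    intro p
    by_cases hp : p ∈ P.carrier.extremePoints ℝ
    · obtain ⟨C, hC⟩ := hφ₀.exists_vertex_bound hp
      exact ⟨C, fun _ => hC⟩
    · exact ⟨0, fun h => absurd h hp⟩
  choose C hC using h
  obtain ⟨B, hB⟩ := (P.finite_extremePoints.image C).bddAbove
  refine ⟨B, fun x hx ξ => ?_⟩
  obtain ⟨p, hp, hmax⟩ := P.exists_vertex_isMaxOn ξ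
  linarith [hmax x hx, hC p hp ξ hmax, hB (mem_image_of_mem C hp)]

lemma IsReferencePotential.bddAbove (hφ₀ : IsReferencePotential P φ₀) {x : E n}
    (hx : x ∈ P.carrier) : BddAbove (range fun ξ : E n => ⟪x, ξ⟫ - φ₀ ξ) := by
  obtain ⟨C, hC⟩ := hφ₀.exists_bound
  exact ⟨C, forall_mem_range.2 (hC x hx)⟩

lemma exists_inner_eq_mul_norm (ξ : E n) {r : ℝ} (hr : 0 ≤ r) :
    ∃ x : E n, ‖x‖ ≤ r ∧ ⟪x, ξ⟫ = r * ‖ξ‖ := by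
  rcases eq_or_ne ξ 0 with rfl | h0
  · exact ⟨0, by simpa using hr, by simp⟩
  · have hn : ‖ξ‖ ≠ 0 := norm_ne_zero_iff.2 h0
    refine ⟨(r / ‖ξ‖) • ξ, ?_, ?_⟩
    · rw [norm_smul, norm_div, norm_norm, Real.norm_of_nonneg hr, div_mul_cancel₀ _ hn]
    · rw [inner_smul_left, real_inner_self_eq_norm_sq, conj_trivial]
      field_simp

lemma IsReferencePotential.exists_isMin (hφ₀ : IsReferencePotential P φ₀) :
    ∃ ξ₀, ∀ ξ, φ₀ ξ₀ ≤ φ₀ ξ := by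
  obtain ⟨C, hC⟩ := hφ₀.exists_bound
  obtain ⟨r, hr, hrP⟩ := P.exists_closedBall_subset
  have hgrow : ∀ ξ, r * ‖ξ‖ - C ≤ φ₀ ξ := by
    intro ξ
    obtain ⟨x, hx, hxξ⟩ := exists_inner_eq_mul_norm ξ hr.le
    linarith [hC x (interior_subset (hrP (mem_closedBall_zero_iff.2 hx))) ξ]
  refine hφ₀.continuous.exists_forall_le ?_
  refine tendsto_atTop_mono hgrow ?_
  exact tendsto_atTop_add_const_right _ _ ((tendsto_norm_cocompact_atTop).const_mul_atTop hr)

lemma IsReferencePotential.convexOn_legendre (hφ₀ : IsReferencePotential P φ₀) :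
    ConvexOn ℝ P.carrier (legendre φ₀) := by
  refine ⟨P.convex_carrier, fun x hx y hy a b ha hb hab => ciSup_le fun ξ => ?_⟩
  have h1 := le_ciSup (hφ₀.bddAbove hx) ξ
  have h2 := le_ciSup (hφ₀.bddAbove hy) ξ
  simp only [smul_eq_mul, inner_add_left, inner_smul_left, conj_trivial]
  calc a * ⟪x, ξ⟫ + b * ⟪y, ξ⟫ - φ₀ ξ
      = a * (⟪x, ξ⟫ - φ₀ ξ) + b * (⟪y, ξ⟫ - φ₀ ξ) := by
        linear_combination φ₀ ξ * hab
    _ ≤ a * legendre φ₀ x + b * legendre φ₀ y :=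
        add_le_add (mul_le_mul_of_nonneg_left h1 ha) (mul_le_mul_of_nonneg_left h2 hb)

lemma IsReferencePotential.continuousOn_legendre (hφ₀ : IsReferencePotential P φ₀) :
    ContinuousOn (legendre φ₀) P.carrier := by
  obtain ⟨C, hC⟩ := hφ₀.exists_bound
  refine P.continuousOn_of_convexOn hφ₀.convexOn_legendre (fun x hx => ?_)
    (fun x hx => ciSup_le (hC x hx))
  refine lowerSemicontinuousWithinAt_ciSup ?_ fun ξ => ?_
  · filter_upwards [self_mem_nhdsWithin] with y hy using hφ₀.bddAbove hy
  · have : Continuous fun x : E n => ⟪x, ξ⟫ - φ₀ ξ := by fun_prop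
    exact this.continuousWithinAt.lowerSemicontinuousWithinAt

/-- The Legendre dual of `φ₀`, corrected by its supporting affine function at the origin, is a
normalized potential. Convex functions smooth up to the boundary and normalized in the same way may
be added to it. -/
lemma IsReferencePotential.exists_normalizedPotential (hφ₀ : IsReferencePotential P φ₀) :
    ∃ v ∈ P.normalizedPotentials φ₀, ∀ h : E n → ℝ, ContDiff ℝ ∞ h → ConvexOn ℝ univ h →
      (∀ x, 0 ≤ h x) → h 0 = 0 → v + h ∈ P.normalizedPotentials φ₀ := by
  obtain ⟨ξ₀, hξ₀⟩ := hφ₀.exists_isMin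
  have hle : ∀ x ∈ P.carrier, ⟪x, ξ₀⟫ - φ₀ ξ₀ ≤ legendre φ₀ x := fun x hx =>
    le_ciSup (hφ₀.bddAbove hx) ξ₀
  have h0 : legendre φ₀ 0 = -φ₀ ξ₀ := by
    refine le_antisymm (ciSup_le fun ξ => ?_) ?_
    · simpa using hξ₀ ξ
    · simpa using hle 0 P.zero_mem_carrier
  let v : E n → ℝ := fun x => legendre φ₀ x + (φ₀ ξ₀ - ⟪x, ξ₀⟫)
  have key : ∀ h : E n → ℝ, ContDiff ℝ ∞ h → ConvexOn ℝ univ h →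
      (∀ x, 0 ≤ h x) → h 0 = 0 → v + h ∈ P.normalizedPotentials φ₀ := by
    intro h hs hc hnn hz
    have hv0 : (v + h) 0 = 0 := by simp [v, h0, hz]
    refine ⟨⟨?_, ?_, ?_⟩, fun x hx => ?_, hv0⟩
    · refine ContinuousOn.add (hφ₀.continuousOn_legendre.add ?_) hs.continuous.continuousOn
      exact Continuous.continuousOn (by fun_prop)
    · refine ConvexOn.add (ConvexOn.add ?_ ?_) (hc.subset (subset_univ _) P.convex_delta)
      · exact hφ₀.convexOn_legendre.subset interior_subset P.convex_delta
      · refine ⟨P.convex_delta, fun x _ y _ a b _ _ hab => le_of_eq ?_⟩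
        simp only [smul_eq_mul, inner_add_left, inner_smul_left, conj_trivial]
        linear_combination (-φ₀ ξ₀) * hab
    · have hd : ContDiff ℝ ∞ fun x : E n => (φ₀ ξ₀ - ⟪x, ξ₀⟫) + h x :=
        (contDiff_const.sub (contDiff_id.inner ℝ contDiff_const)).add hs
      refine hd.contDiffOn.congr fun x _ => ?_
      simp only [v, Pi.add_apply]
      ring
    · rw [hv0]
      have := hle x hx
      have := hnn x
      simp only [v, Pi.add_apply]
      linarith
  refine ⟨v, ?_, key⟩
  simpa using key 0 contDiff_const (convexOn_const 0 convex_univ) (fun _ => le_rfl) rfl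

/-! ### The affine function `l` and the invariant `α_X` -/

lemma Polytope.integral_mul_ell (P : Polytope n) (f : E n →ᵃ[ℝ] ℝ) :
    ∫ x in P.delta, f x * P.ell x = f 0 := by
  have h : ∀ f : E n →ᵃ[ℝ] ℝ, -f 0 + ∫ x in P.delta, f x * P.ell x = 0 :=
    P.existsUnique_ell.choose_spec.1
  linarith [h f]

lemma Polytope.integral_ell (P : Polytope n) : ∫ x in P.delta, P.ell x = 1 := by
  simpa using P.integral_mul_ell (AffineMap.const ℝ (E n) 1)

lemma Polytope.continuous_ell (P : Polytope n) : Continuous P.ell :=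
  P.ell.continuous_of_finiteDimensional

lemma Polytope.contDiff_ell (P : Polytope n) : ContDiff ℝ ∞ P.ell := by
  rw [AffineMap.decomp P.ell]
  exact (LinearMap.toContinuousLinearMap P.ell.linear).contDiff.add contDiff_const

lemma Polytope.setIntegral_pos (P : Polytope n) {f : E n → ℝ} (hf : Continuous f)
    (hnn : ∀ x, 0 ≤ f x) {x : E n} (hx : x ∈ P.delta) (hfx : 0 < f x) :
    0 < ∫ x in P.delta, f x := by
  refine (integral_nonneg hnn).lt_of_ne' fun h => hfx.ne' ?_
  have h1 := (setIntegral_eq_zero_iff_of_nonneg_ae (Eventually.of_forall hnn)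
    (P.integrableOn_delta hf)).1 h
  exact Measure.eqOn_open_of_ae_eq h1 isOpen_interior hf.continuousOn continuousOn_const hx

lemma Polytope.vol_pos (P : Polytope n) : 0 < P.vol :=
  P.setIntegral_pos continuous_const (fun _ => zero_le_one) P.zero_mem zero_lt_one

lemma Polytope.alpha_le_one_iff (P : Polytope n) :
    P.alpha ≤ 1 ↔ ∀ x ∈ P.carrier, 0 ≤ P.ell x := by
  have hc : Continuous fun x => 1 - P.vol * P.ell x :=
    continuous_const.sub (continuous_const.mul P.continuous_ell)
  have hb := (P.isCompact_carrier.image hc).bddAbove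
  rw [Polytope.alpha, csSup_le_iff hb ⟨_, mem_image_of_mem _ P.zero_mem_carrier⟩, forall_mem_image]
  refine forall₂_congr fun x _ => ?_
  rw [sub_le_self_iff, mul_nonneg_iff_of_pos_left P.vol_pos]

/-- If `l` is negative somewhere on the polytope, some smooth normalized convex function
destabilizes. It is `e^{-s l}` minus its affine Taylor polynomial at the origin, for large `s`. -/
lemma Polytope.exists_destabilizing (P : Polytope n) {x₀ : E n} (hx₀ : x₀ ∈ P.carrier)
    (hneg : P.ell x₀ < 0) :
    ∃ h : E n → ℝ, ContDiff ℝ ∞ h ∧ ConvexOn ℝ univ h ∧ (∀ x, 0 ≤ h x) ∧ h 0 = 0 ∧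
      ∫ x in P.delta, h x * P.ell x < 0 := by
  have hlc := P.continuous_ell
  have hmc : Continuous fun x => min (P.ell x) 0 ^ 2 := (hlc.min continuous_const).pow 2
  set c : ℝ := ∫ x in P.delta, min (P.ell x) 0 ^ 2 with hcdef
  have hc : 0 < c := by
    obtain ⟨x, hxn, hx⟩ := mem_closure_iff.1 (P.carrier_subset_closure hx₀) {x | P.ell x < 0}
      (isOpen_lt hlc continuous_const) hneg
    refine P.setIntegral_pos hmc (fun _ => sq_nonneg _) hx ?_
    rw [min_eq_left (le_of_lt hxn)]
    exact sq_pos_of_neg hxn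
  set s : ℝ := c⁻¹ with hs
  have hs0 : 0 < s := inv_pos.2 hc
  set b : ℝ := Real.exp (-s * P.ell 0) with hb
  have hb0 : 0 < b := Real.exp_pos _
  let g : ℝ → ℝ := fun t => Real.exp (-s * t) + (s * b * t - (b + s * b * P.ell 0))
  have hgc : ConvexOn ℝ univ g := by
    refine ConvexOn.add ?_ ?_
    · exact convexOn_exp.comp_linearMap (LinearMap.mulLeft ℝ (-s))
    · refine ⟨convex_univ, fun x _ y _ p q _ _ hpq => le_of_eq ?_⟩
      simp only [smul_eq_mul]
      linear_combination (b + s * b * P.ell 0) * hpq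
  have hgs : ContDiff ℝ ∞ g := by fun_prop
  refine ⟨fun x => g (P.ell x), hgs.comp P.contDiff_ell, hgc.comp_affineMap P.ell, fun x => ?_, ?_,
    ?_⟩
  · have h1 := Real.add_one_le_exp (-s * (P.ell x - P.ell 0))
    have h2 : Real.exp (-s * P.ell x) = b * Real.exp (-s * (P.ell x - P.ell 0)) := by
      rw [hb, ← Real.exp_add]
      ring_nf
    simp only [g]
    rw [h2]
    nlinarith
  · simp only [g, ← hb]
    ring
  · have hle : ∀ t : ℝ, Real.exp (-s * t) * t ≤ t - s * min t 0 ^ 2 := by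
      intro t
      rcases le_total 0 t with ht | ht
      · rw [min_eq_right ht]
        have : Real.exp (-s * t) ≤ 1 := Real.exp_le_one_iff.2 (by nlinarith)
        nlinarith
      · rw [min_eq_left ht]
        nlinarith [Real.add_one_le_exp (-s * t)]
    have hi1 := P.integrableOn_delta hlc
    have hi2 := P.integrableOn_delta hmc
    have hi3 : IntegrableOn (fun x => P.ell x * P.ell x) P.delta :=
      P.integrableOn_delta (hlc.mul hlc)
    have hi12 : IntegrableOn (fun x => (1 - (b + s * b * P.ell 0)) * P.ell x
        - s * min (P.ell x) 0 ^ 2) P.delta := (hi1.const_mul _).sub (hi2.const_mul _)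
    have hgi : Continuous fun x => g (P.ell x) * P.ell x :=
      (hgs.continuous.comp hlc).mul hlc
    calc ∫ x in P.delta, g (P.ell x) * P.ell x
        ≤ ∫ x in P.delta, ((1 - (b + s * b * P.ell 0)) * P.ell x - s * min (P.ell x) 0 ^ 2
            + s * b * (P.ell x * P.ell x)) := by
          refine setIntegral_mono (P.integrableOn_delta hgi)
            (hi12.add (hi3.const_mul _)) fun x => ?_
          have := hle (P.ell x)
          simp only [g]
          nlinarith
      _ = (1 - (b + s * b * P.ell 0)) * 1 - s * c + s * b * P.ell 0 := by
          rw [integral_add hi12 (hi3.const_mul _),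
            integral_sub (hi1.const_mul _) (hi2.const_mul _), integral_const_mul,
            integral_const_mul, integral_const_mul, P.integral_ell, P.integral_mul_ell]
      _ = -b := by
          rw [hs, inv_mul_cancel₀ hc.ne']
          ring
      _ < 0 := neg_lt_zero.2 hb0

/-! ### Bounds for the Ding functional -/

lemma integrable_exp_neg_mul_norm {a : ℝ} (ha : 0 < a) :
    Integrable fun ξ : E n => Real.exp (-(a * ‖ξ‖)) := by
  have hdim : (Module.finrank ℝ (E n) : ℝ) < ((n + 1 : ℕ) : ℝ) := by simp
  refine ((integrable_one_add_norm (μ := (volume : Measure (E n))) hdim).const_mul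
    ((n + 1).factorial * Real.exp a / a ^ (n + 1))).mono' ?_ (Eventually.of_forall fun ξ => ?_)
  · exact Continuous.aestronglyMeasurable (by fun_prop)
  · have h0 : 0 < 1 + ‖ξ‖ := by positivity
    have h := Real.pow_div_factorial_le_exp _ (mul_nonneg ha.le h0.le) (n + 1)
    have he : Real.exp (-(a * ‖ξ‖)) = Real.exp a / Real.exp (a * (1 + ‖ξ‖)) := by
      rw [← Real.exp_sub]
      ring_nf
    rw [Real.norm_of_nonneg (Real.exp_pos _).le, Real.rpow_neg h0.le, Real.rpow_natCast, he,
      ← div_eq_mul_inv, div_div, div_le_div_iff₀ (Real.exp_pos _) (by positivity)]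
    rw [div_le_iff₀ (by positivity), mul_pow] at h
    nlinarith [Real.exp_pos a]

/-- The mean value inequality for convex functions: near the origin a nonnegative potential is
bounded by a multiple of its integral. -/
lemma Polytope.exists_le_mul_integral (P : Polytope n) :
    ∃ r A : ℝ, 0 < r ∧ 0 < A ∧ Metric.closedBall (0 : E n) r ⊆ P.delta ∧
      ∀ u : E n → ℝ, ContinuousOn u P.carrier → ConvexOn ℝ P.delta u → (∀ x ∈ P.carrier, 0 ≤ u x) →
        ∀ x, ‖x‖ ≤ r → u x ≤ A * ∫ y in P.delta, u y := by
  obtain ⟨R, hR, hRP⟩ := P.exists_closedBall_subset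
  have hmem : ∀ x : E n, ‖x‖ ≤ R → x ∈ P.delta := fun x hx => hRP (mem_closedBall_zero_iff.2 hx)
  set B : Set (E n) := Metric.ball 0 (R / 2) with hB
  have hBfin : volume B ≠ ⊤ := measure_ball_lt_top.ne
  have hV : 0 < volume.real B :=
    ENNReal.toReal_pos (Metric.measure_ball_pos _ _ (half_pos hR)).ne' hBfin
  refine ⟨R / 2, (volume.real B)⁻¹, half_pos hR, inv_pos.2 hV,
    (Metric.closedBall_subset_closedBall (by linarith)).trans hRP, fun u hu hconv hnn x hx => ?_⟩
  have hui : IntegrableOn u P.delta :=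
    (hu.integrableOn_compact P.isCompact_carrier).mono_set interior_subset
  set w : E n → ℝ := P.delta.indicator u with hw
  have hms : MeasurableSet P.delta := isOpen_interior.measurableSet
  have hwi : Integrable w := hui.integrable_indicator hms
  have hwnn : ∀ y, 0 ≤ w y := fun y => indicator_nonneg (fun z hz => hnn z (interior_subset hz)) y
  have hw1 : Integrable fun y => w (x + y) := hwi.comp_add_left x
  have hw2 : Integrable fun y => w (x - y) := hwi.comp_sub_left x
  -- Convexity between the symmetric points `x + y` and `x - y`, integrated over `y ∈ B`.
  have h1 : ∀ y ∈ B, 2 * u x ≤ w (x + y) + w (x - y) := by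
    intro y hy
    have hy' : ‖y‖ < R / 2 := mem_ball_zero_iff.1 hy
    have hp : x + y ∈ P.delta := hmem _ ((norm_add_le _ _).trans (by linarith))
    have hq : x - y ∈ P.delta := hmem _ ((norm_sub_le _ _).trans (by linarith))
    have h := hconv.2 hp hq one_half_pos.le one_half_pos.le (add_halves 1)
    have he : (1 / 2 : ℝ) • (x + y) + (1 / 2 : ℝ) • (x - y) = x := by
      rw [← smul_add, add_add_sub_cancel, ← two_smul ℝ x, smul_smul]
      norm_num
    rw [he] at h
    simp only [smul_eq_mul] at h
    rw [hw, indicator_of_mem hp, indicator_of_mem hq]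
    linarith
  have h2 : volume.real B * (2 * u x) ≤ 2 * ∫ y in P.delta, u y := by
    calc volume.real B * (2 * u x) = ∫ _y in B, 2 * u x := by
          rw [setIntegral_const, smul_eq_mul]
      _ ≤ ∫ y in B, (w (x + y) + w (x - y)) :=
          setIntegral_mono_on (integrableOn_const hBfin) (hw1.add hw2).integrableOn
            measurableSet_ball h1
      _ ≤ ∫ y, (w (x + y) + w (x - y)) :=
          setIntegral_le_integral (hw1.add hw2)
            (Eventually.of_forall fun y => add_nonneg (hwnn _) (hwnn _))
      _ = 2 * ∫ y in P.delta, u y := by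
          rw [integral_add hw1 hw2, integral_add_left_eq_self, integral_sub_left_eq_self, hw,
            integral_indicator hms]
          ring
  rw [← div_eq_inv_mul, le_div_iff₀ hV]
  linarith

section Normalized

variable {u : E n → ℝ}

lemma Polytope.nonneg_of_mem_normalizedPotentials (hu : u ∈ P.normalizedPotentials φ₀) {x : E n}
    (hx : x ∈ P.carrier) : 0 ≤ u x :=
  hu.2.2 ▸ hu.2.1 x hx

lemma Polytope.integrableOn_of_mem_normalizedPotentials (hu : u ∈ P.normalizedPotentials φ₀) :
    IntegrableOn u P.delta :=
  (hu.1.1.integrableOn_compact P.isCompact_carrier).mono_set interior_subset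

lemma Polytope.integrableOn_mul_ell (hu : u ∈ P.normalizedPotentials φ₀) :
    IntegrableOn (fun x => u x * P.ell x) P.delta :=
  ((hu.1.1.mul P.continuous_ell.continuousOn).integrableOn_compact
    P.isCompact_carrier).mono_set interior_subset

lemma Polytope.inner_sub_le_mul_norm (hu : u ∈ P.normalizedPotentials φ₀) {R : ℝ}
    (hR : ∀ x ∈ P.carrier, ‖x‖ ≤ R) (ξ : E n) (x : P.carrier) :
    ⟪(x : E n), ξ⟫ - u x ≤ R * ‖ξ‖ := by
  have h1 := real_inner_le_norm (x : E n) ξ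
  have h2 := mul_le_mul_of_nonneg_right (hR x x.2) (norm_nonneg ξ)
  linarith [P.nonneg_of_mem_normalizedPotentials hu x.2]

lemma Polytope.bddAbove_inner_sub (hu : u ∈ P.normalizedPotentials φ₀) (ξ : E n) :
    BddAbove (range fun x : P.carrier => ⟪(x : E n), ξ⟫ - u x) := by
  obtain ⟨R, hR⟩ := P.isCompact_carrier.isBounded.exists_norm_le
  exact ⟨R * ‖ξ‖, forall_mem_range.2 (P.inner_sub_le_mul_norm hu hR ξ)⟩

lemma Polytope.inner_sub_le_legendre (hu : u ∈ P.normalizedPotentials φ₀) {x : E n}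
    (hx : x ∈ P.carrier) (ξ : E n) : ⟪x, ξ⟫ - u x ≤ P.legendre u ξ :=
  le_ciSup (P.bddAbove_inner_sub hu ξ) (⟨x, hx⟩ : P.carrier)

lemma Polytope.iInf_legendre (hu : u ∈ P.normalizedPotentials φ₀) :
    ⨅ ξ, P.legendre u ξ = 0 := by
  have : Nonempty P.carrier := ⟨⟨0, P.zero_mem_carrier⟩⟩
  have hnn : ∀ ξ, 0 ≤ P.legendre u ξ := fun ξ => by
    simpa [hu.2.2] using P.inner_sub_le_legendre hu P.zero_mem_carrier ξ
  refine le_antisymm ((ciInf_le ⟨0, forall_mem_range.2 hnn⟩ 0).trans ?_) (le_ciInf hnn)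
  refine ciSup_le fun x => ?_
  simpa using P.nonneg_of_mem_normalizedPotentials hu x.2

lemma Polytope.ding_eq (hu : u ∈ P.normalizedPotentials φ₀) :
    P.ding u = -Real.log (∫ ξ, Real.exp (-P.legendre u ξ)) + P.dingFutaki u := by
  simp only [Polytope.ding, Polytope.dingFutaki, P.iInf_legendre hu, sub_zero]
  ring

lemma Polytope.measurable_legendre (hu : u ∈ P.normalizedPotentials φ₀) :
    Measurable (P.legendre u) := by
  refine (lowerSemicontinuous_ciSup (P.bddAbove_inner_sub hu) fun x => ?_).measurable
  exact Continuous.lowerSemicontinuous (by fun_prop)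

/-- A bound `u ≤ M` on the ball of radius `r` gives, by convexity and `u 0 = 0`, the bound `u ≤ δ M`
on the ball of radius `δ r`; the points of that ball bound the Legendre dual from below. -/
lemma Polytope.le_legendre (hu : u ∈ P.normalizedPotentials φ₀) {r M : ℝ} (hr : 0 ≤ r)
    (hrP : Metric.closedBall (0 : E n) r ⊆ P.delta) (hM : ∀ x, ‖x‖ ≤ r → u x ≤ M) {δ : ℝ}
    (hδ0 : 0 ≤ δ) (hδ1 : δ ≤ 1) (ξ : E n) : δ * r * ‖ξ‖ - δ * M ≤ P.legendre u ξ := by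
  obtain ⟨x, hx, hxξ⟩ := exists_inner_eq_mul_norm ξ hr
  have hxP : x ∈ P.delta := hrP (mem_closedBall_zero_iff.2 hx)
  have hconv := hu.1.2.1.2 hxP P.zero_mem hδ0 (sub_nonneg.2 hδ1) (by ring)
  have hδx : δ • x ∈ P.carrier := by
    have := P.convex_delta hxP P.zero_mem hδ0 (sub_nonneg.2 hδ1) (by ring)
    rw [smul_zero, add_zero] at this
    exact interior_subset this
  rw [smul_zero, add_zero, hu.2.2, smul_zero, add_zero, smul_eq_mul] at hconv
  have h1 := P.inner_sub_le_legendre hu hδx ξ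
  rw [inner_smul_left, hxξ, conj_trivial] at h1
  nlinarith [mul_le_mul_of_nonneg_left (hM x hx) hδ0]

lemma Polytope.integrable_exp_neg_legendre (hu : u ∈ P.normalizedPotentials φ₀) :
    Integrable fun ξ => Real.exp (-P.legendre u ξ) := by
  obtain ⟨r, A, hr, -, hrP, hA⟩ := P.exists_le_mul_integral
  have hM := hA u hu.1.1 hu.1.2.1 fun x hx => P.nonneg_of_mem_normalizedPotentials hu hx
  refine ((integrable_exp_neg_mul_norm hr).const_mul
    (Real.exp (A * ∫ y in P.delta, u y))).mono' ?_ (Eventually.of_forall fun ξ => ?_)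
  · exact (Real.measurable_exp.comp (P.measurable_legendre hu).neg).aestronglyMeasurable
  · rw [Real.norm_of_nonneg (Real.exp_pos _).le, ← Real.exp_add]
    have := P.le_legendre hu hr.le hrP hM zero_le_one le_rfl ξ
    exact Real.exp_le_exp.2 (by linarith)

end Normalized

variable (P φ₀) in
/-- The Ding functional is at most the Ding–Futaki invariant up to a constant, because the Legendre
dual of a normalized potential is at most `R ‖ξ‖`. -/
lemma Polytope.exists_ding_le :
    ∃ B : ℝ, ∀ u ∈ P.normalizedPotentials φ₀, P.ding u ≤ B + P.dingFutaki u := by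
  obtain ⟨R, hR0, hR⟩ := P.isCompact_carrier.isBounded.exists_pos_norm_le
  have : Nonempty P.carrier := ⟨⟨0, P.zero_mem_carrier⟩⟩
  refine ⟨-Real.log (∫ ξ : E n, Real.exp (-(R * ‖ξ‖))), fun u hu => ?_⟩
  rw [P.ding_eq hu]
  have hi := integrable_exp_neg_mul_norm (n := n) hR0
  refine add_le_add_left (neg_le_neg (Real.log_le_log (integral_exp_pos hi) ?_)) _
  refine integral_mono hi (P.integrable_exp_neg_legendre hu) fun ξ => ?_
  exact Real.exp_le_exp.2 (neg_le_neg (ciSup_le (P.inner_sub_le_mul_norm hu hR ξ)))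

variable (P φ₀) in
/-- The logarithmic term of the Ding functional grows slower than any multiple of `∫ u`. -/
lemma Polytope.exists_le_ding {ε : ℝ} (hε : 0 < ε) :
    ∃ C : ℝ, 0 < C ∧ ∀ u ∈ P.normalizedPotentials φ₀,
      -ε * (∫ x in P.delta, u x) - C + P.dingFutaki u ≤ P.ding u := by
  obtain ⟨r, A, hr, hA0, hrP, hA⟩ := P.exists_le_mul_integral
  set δ : ℝ := min 1 (ε / A) with hδ
  have hδ0 : 0 < δ := lt_min one_pos (div_pos hε hA0)
  have hδA : δ * A ≤ ε := (le_div_iff₀ hA0).1 (min_le_right _ _)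
  have hi := integrable_exp_neg_mul_norm (n := n) (mul_pos hδ0 hr)
  set J : ℝ := ∫ ξ : E n, Real.exp (-(δ * r * ‖ξ‖)) with hJ
  have hJ0 : 0 < J := integral_exp_pos hi
  refine ⟨|Real.log J| + 1, by positivity, fun u hu => ?_⟩
  have hnn : ∀ x ∈ P.carrier, 0 ≤ u x := fun x hx => P.nonneg_of_mem_normalizedPotentials hu hx
  have hM := hA u hu.1.1 hu.1.2.1 hnn
  set m : ℝ := ∫ x in P.delta, u x with hm
  have hm0 : 0 ≤ m :=
    setIntegral_nonneg isOpen_interior.measurableSet fun x hx => hnn x (interior_subset hx)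
  have hui := P.integrable_exp_neg_legendre hu
  have hle : ∫ ξ, Real.exp (-P.legendre u ξ) ≤ Real.exp (δ * (A * m)) * J := by
    rw [hJ, ← integral_const_mul]
    refine integral_mono hui (hi.const_mul _) fun ξ => ?_
    dsimp only
    rw [← Real.exp_add]
    have := P.le_legendre hu hr.le hrP hM hδ0.le (min_le_left _ _) ξ
    exact Real.exp_le_exp.2 (by linarith)
  have hlog := Real.log_le_log (integral_exp_pos hui) hle
  rw [Real.log_mul (Real.exp_pos _).ne' hJ0.ne', Real.log_exp] at hlog
  rw [P.ding_eq hu]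
  nlinarith [le_abs_self (Real.log J), mul_le_mul_of_nonneg_right hδA hm0]

/-! ### Stability and destabilizing rays -/

lemma Polytope.dingFutaki_nonneg (hl : ∀ x ∈ P.carrier, 0 ≤ P.ell x) {u : E n → ℝ}
    (hu : u ∈ P.normalizedPotentials φ₀) : 0 ≤ P.dingFutaki u := by
  rw [Polytope.dingFutaki, hu.2.2, neg_zero, zero_add]
  exact setIntegral_nonneg isOpen_interior.measurableSet fun x hx =>
    mul_nonneg (P.nonneg_of_mem_normalizedPotentials hu (interior_subset hx))
      (hl x (interior_subset hx))

/-- If `l` is negative somewhere, there is a ray `v + K h` of normalized potentials along which the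
Ding–Futaki invariant decreases linearly. -/
lemma IsReferencePotential.exists_destabilizing_ray (hφ₀ : IsReferencePotential P φ₀)
    (hα : ¬ P.alpha ≤ 1) :
    ∃ v h : E n → ℝ, ∃ H I : ℝ, 0 ≤ H ∧ I < 0 ∧ ∀ K : ℝ, 0 ≤ K →
      v + K • h ∈ P.normalizedPotentials φ₀ ∧
      ∫ x in P.delta, (v + K • h) x = (∫ x in P.delta, v x) + K * H ∧
      P.dingFutaki (v + K • h) = P.dingFutaki v + K * I := by
  rw [P.alpha_le_one_iff] at hα
  push Not at hα
  obtain ⟨x₀, hx₀, hneg⟩ := hα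
  obtain ⟨h, hs, hc, hnn, h0, hI⟩ := P.exists_destabilizing hx₀ hneg
  obtain ⟨v, hv, hvh⟩ := hφ₀.exists_normalizedPotential
  refine ⟨v, h, ∫ x in P.delta, h x, ∫ x in P.delta, h x * P.ell x, integral_nonneg hnn, hI,
    fun K hK => ⟨?_, ?_, ?_⟩⟩
  · refine hvh _ (contDiff_const.smul hs) (hc.smul hK) (fun x => mul_nonneg hK (hnn x)) ?_
    simp [h0]
  · simp only [Pi.add_apply, Pi.smul_apply, smul_eq_mul]
    rw [integral_add (P.integrableOn_of_mem_normalizedPotentials hv)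
      ((P.integrableOn_delta hs.continuous).const_mul K), integral_const_mul]
  · simp only [Polytope.dingFutaki, Pi.add_apply, Pi.smul_apply, smul_eq_mul, h0, add_mul,
      mul_assoc]
    have hi : IntegrableOn (fun x => h x * P.ell x) P.delta :=
      P.integrableOn_delta (hs.continuous.mul P.continuous_ell)
    rw [integral_add (P.integrableOn_mul_ell hv) (hi.const_mul K), integral_const_mul]
    ring

end ToricFano

theorem mainTheorem1 {n : ℕ} (P : ToricFano.Polytope n) (φ₀ : ToricFano.E n → ℝ)
    (hφ₀ : ToricFano.IsReferencePotential P φ₀) :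
    List.TFAE [
      P.alpha ≤ 1,
      ∀ u ∈ P.normalizedPotentials φ₀, 0 ≤ P.dingFutaki u,
      ∀ ε : ℝ, 0 < ε → ∃ C : ℝ, 0 < C ∧ ∀ u ∈ P.normalizedPotentials φ₀,
        -ε * (∫ x in P.delta, u x) - C ≤ P.ding u] := by
  tfae_have 1 → 2 := fun hα u hu => P.dingFutaki_nonneg (P.alpha_le_one_iff.1 hα) hu
  tfae_have 2 → 3 := by
    intro hb ε hε
    obtain ⟨C, hC, h⟩ := P.exists_le_ding φ₀ hε
    exact ⟨C, hC, fun u hu => by linarith [h u hu, hb u hu]⟩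
  tfae_have 3 → 1 := by
    intro hd
    by_contra hα
    obtain ⟨v, h, H, I, hH, hI, hray⟩ := hφ₀.exists_destabilizing_ray hα
    obtain ⟨B, hB⟩ := P.exists_ding_le φ₀
    -- With this `ε` the slope `I + ε H` of the difference of the two sides is still negative.
    set ε : ℝ := -I / (H + 1) with hε
    have hε0 : 0 < ε := div_pos (neg_pos.2 hI) (by linarith)
    have hεH : ε * (H + 1) = -I := div_mul_cancel₀ _ (by linarith)
    obtain ⟨C, -, hC⟩ := hd ε hε0
    obtain ⟨K, hK⟩ := exists_nat_gt
      ((B + P.dingFutaki v + ε * (∫ x in P.delta, v x) + C) / ε)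
    rw [div_lt_iff₀ hε0] at hK
    obtain ⟨hmem, hint, hfut⟩ := hray K K.cast_nonneg
    have h1 := hC _ hmem
    have h2 := hB _ hmem
    rw [hint] at h1
    rw [hfut] at h2
    have h3 : (K : ℝ) * (ε * (H + 1)) = K * -I := by rw [hεH]
    linarith
  tfae_finish
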